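/- Let $R$ be a finite local commutative ring with identity that is not a field, with maximal ideal $\mathrm{rad}(R)$ and residue field $\mathbb F=R/\mathrm{rad}(R)$ of order $q$. Write $R^\times=\mathcal T\times\mathcal U$, where $\mathcal U=1+\mathrm{rad}(R)$ is the group of principal units and $\mathcal T=\{t\in R^\times: t^{q-1}=1\}$ is the Teichmüller group, which is cyclic of order $q-1$. Let $K$ be a subgroup of $R^\times$. The cyclotomic scheme $\mathrm{Cyc}(K,R)$ is the association scheme on $R$ whose basis relations are the sets $\{(x,y)\in R\times R: y-x\in rK\}$, $r\in R$. Its automorphism group $\mathrm{Aut}(\mathrm{Cyc}(K,R))$ consists of all permutations $f$ of $R$ that leave each basis relation invariant (as a set). Let $\mathrm{AGL}_1(R)$ be the group of all permutations $x\mapsto ax+b$ of $R$ with $a\in R^\times$ and $b\in R$. For a finite local commutative ring $S$, a subgroup $L\le S^\times$ is called pure if the only ideal $I$ of $S$ with $1+I\subseteq L$ is $I=\{0\}$. Put $I_0(S)=\{x\in\mathrm{rad}(S): x\,\mathrm{rad}(S)=\{0\}\}$. The group $L$ is called strongly pure if it is pure and, unless $S$ is a field, the image of $L$ in $(S/I_0(S))^\times$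 is strongly pure. (This is a recursive definition; it ends because $I_0(S)\neq\{0\}$ when $S$ is not a field.) Then $\mathrm{Aut}(\mathrm{Cyc}(K,R))\le \mathrm{AGL}_1(R)$ whenever at least one of the following conditions holds: (1) $K\le\mathcal T$; (2) $K$ is a strongly pure subgroup of $\mathcal U$; (3) $K$ is strongly pure and the residue field $\mathbb F$ is prime, that is, $q$ is a prime number. -/

import Mathlib

open scoped Pointwise

universe u

/-- A coherent configuration ("scheme") on a finite set `V`: a partition of `V × V` into nonempty
basis relations, closed under transposition, such that the diagonal is a union of basis relations
and the intersection numbers are well defined. -/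
structure CoherentConfiguration (V : Type u) [Finite V] where
  rels : Set (Set (V × V))
  isPartition : Setoid.IsPartition rels
  transpose_mem : ∀ S ∈ rels, Prod.swap ⁻¹' S ∈ rels
  diagonal_eq : ∃ D ⊆ rels, ⋃₀ D = Set.diagonal V
  intersection : ∀ A ∈ rels, ∀ B ∈ rels, ∀ C ∈ rels, ∀ p ∈ C, ∀ q ∈ C,
    {v : V | (p.1, v) ∈ A ∧ (v, p.2) ∈ B}.ncard = {v : V | (q.1, v) ∈ A ∧ (v, q.2) ∈ B}.ncard

/-- The automorphism group of a scheme: all permutations of the points fixing every basis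
relation. -/
def CoherentConfiguration.aut {V : Type u} [Finite V] (X : CoherentConfiguration V) :
    Subgroup (Equiv.Perm V) where
  carrier := {f | ∀ S ∈ X.rels, Prod.map f f '' S = S}
  one_mem' := by
    intro S _
    simp
  mul_mem' := by
    intro f g hf hg S hS
    have h : Prod.map (f * g : Equiv.Perm V) (f * g : Equiv.Perm V)
        = Prod.map f f ∘ Prod.map g g := by
      funext x; rfl
    rw [h, Set.image_comp, hg S hS, hf S hS]
  inv_mem' := by
    intro f hf S hS
    have h : Prod.map (f⁻¹ : Equiv.Perm V) (f⁻¹ : Equiv.Perm V) ∘ Prod.map f f = id := by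
      funext x
      exact Prod.ext (f.symm_apply_apply x.1) (f.symm_apply_apply x.2)
    conv_lhs => rw [← hf S hS]
    rw [← Set.image_comp, h, Set.image_id]

section Ring

variable {R : Type u} [CommRing R]

/-- The binary relation `{(x, y) : y - x ∈ r K}` on `R`. -/
def cycRel (K : Subgroup Rˣ) (r : R) : Set (R × R) :=
  {p | ∃ k ∈ K, p.2 - p.1 = r * (k : R)}

theorem mem_cycRel_self (K : Subgroup Rˣ) (p : R × R) : p ∈ cycRel K (p.2 - p.1) :=
  ⟨1, K.one_mem, by simp⟩

theorem cycRel_eq_of_mem {K : Subgroup Rˣ} {r : R} {p : R × R} (hp : p ∈ cycRel K r) :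
    cycRel K r = cycRel K (p.2 - p.1) := by
  obtain ⟨k, hk, h⟩ := hp
  ext q
  constructor
  · rintro ⟨l, hl, h'⟩
    refine ⟨k⁻¹ * l, K.mul_mem (K.inv_mem hk) hl, ?_⟩
    rw [h', h, Units.val_mul, mul_assoc, ← mul_assoc (k : R), Units.mul_inv, one_mul]
  · rintro ⟨l, hl, h'⟩
    refine ⟨k * l, K.mul_mem hk hl, ?_⟩
    rw [h', h, Units.val_mul, mul_assoc]

theorem mem_cycRel_affine {K : Subgroup Rˣ} {a : Rˣ} (ha : a ∈ K) (b r x y : R) :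
    ((a : R) * x + b, (a : R) * y + b) ∈ cycRel K r ↔ (x, y) ∈ cycRel K r := by
  constructor
  · rintro ⟨k, hk, h⟩
    refine ⟨a⁻¹ * k, K.mul_mem (K.inv_mem ha) hk, ?_⟩
    have h' : (a : R) * (y - x) = r * (k : R) := by rw [← h]; ring
    calc y - x = ((a⁻¹ : Rˣ) : R) * ((a : R) * (y - x)) := by
          rw [← mul_assoc, Units.inv_mul, one_mul]
      _ = r * ((a⁻¹ * k : Rˣ) : R) := by rw [h', Units.val_mul]; ring
  · rintro ⟨k, hk, h⟩
    refine ⟨a * k, K.mul_mem ha hk, ?_⟩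
    have h' : y - x = r * (k : R) := h
    calc (a : R) * y + b - ((a : R) * x + b) = (a : R) * (y - x) := by ring
      _ = r * ((a * k : Rˣ) : R) := by rw [h', Units.val_mul]; ring

/-- The cyclotomic scheme `Cyc(K, R)`: its basis relations are the sets
`{(x, y) : y - x ∈ r K}`, `r ∈ R`. -/
def Cyc [Finite R] (K : Subgroup Rˣ) : CoherentConfiguration R where
  rels := Set.range (cycRel K)
  isPartition := by
    constructor
    · rintro ⟨r, hr⟩
      have : ((0 : R), r) ∈ cycRel K r := ⟨1, K.one_mem, by simp⟩
      rw [hr] at this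
      exact this
    · intro p
      refine ⟨cycRel K (p.2 - p.1), ⟨⟨_, rfl⟩, mem_cycRel_self K p⟩, ?_⟩
      rintro _ ⟨⟨r, rfl⟩, hp⟩
      exact cycRel_eq_of_mem hp
  transpose_mem := by
    rintro _ ⟨r, rfl⟩
    refine ⟨-r, ?_⟩
    ext ⟨x, y⟩
    constructor
    · rintro ⟨k, hk, h⟩
      refine ⟨k, hk, ?_⟩
      have h' : y - x = -r * (k : R) := h
      change x - y = r * (k : R)
      linear_combination -h'
    · rintro ⟨k, hk, h⟩
      refine ⟨k, hk, ?_⟩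
      have h' : x - y = r * (k : R) := h
      change y - x = -r * (k : R)
      linear_combination -h'
  diagonal_eq := by
    refine ⟨{cycRel K 0}, by rintro _ rfl; exact ⟨0, rfl⟩, ?_⟩
    rw [Set.sUnion_singleton]
    ext ⟨x, y⟩
    constructor
    · rintro ⟨k, _, h⟩
      have h' : y - x = 0 * (k : R) := h
      rw [zero_mul, sub_eq_zero] at h'
      exact h'.symm
    · intro h
      have h' : x = y := h
      exact ⟨1, K.one_mem, by simp [h']⟩
  intersection := by
    rintro _ ⟨r, rfl⟩ _ ⟨s, rfl⟩ _ ⟨t, rfl⟩ p hp q hq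
    rw [cycRel_eq_of_mem hp] at hq
    obtain ⟨a, ha, h⟩ := hq
    have e1 : (a : R) * p.1 + (q.1 - (a : R) * p.1) = q.1 := by ring
    have e2 : (a : R) * p.2 + (q.1 - (a : R) * p.1) = q.2 := by linear_combination -h
    refine Set.ncard_congr (fun v _ => (a : R) * v + (q.1 - (a : R) * p.1)) ?_ ?_ ?_
    · rintro v ⟨h1, h2⟩
      constructor
      · have := (mem_cycRel_affine ha (q.1 - (a : R) * p.1) r p.1 v).2 h1
        rwa [e1] at this
      · have := (mem_cycRel_affine ha (q.1 - (a : R) * p.1) s v p.2).2 h2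
        rwa [e2] at this
    · intro v w _ _ hvw
      exact a.isUnit.mul_left_cancel (add_right_cancel hvw)
    · rintro w ⟨h1, h2⟩
      have ew : (a : R) * (((a⁻¹ : Rˣ) : R) * (w - (q.1 - (a : R) * p.1)))
          + (q.1 - (a : R) * p.1) = w := by
        rw [← mul_assoc, Units.mul_inv, one_mul, sub_add_cancel]
      refine ⟨((a⁻¹ : Rˣ) : R) * (w - (q.1 - (a : R) * p.1)), ⟨?_, ?_⟩, ew⟩
      · rw [← mem_cycRel_affine ha (q.1 - (a : R) * p.1), e1, ew]
        exact h1
      · rw [← mem_cycRel_affine ha (q.1 - (a : R) * p.1), e2, ew]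
        exact h2

variable (R) in
/-- The group `AGL₁(R)` of all permutations `x ↦ a x + b` of `R` with `a ∈ Rˣ`, `b ∈ R`. -/
def AGLOne : Subgroup (Equiv.Perm R) where
  carrier := {f | ∃ (a : Rˣ) (b : R), ∀ x, f x = (a : R) * x + b}
  one_mem' := ⟨1, 0, by simp⟩
  mul_mem' := by
    rintro f g ⟨a, b, hf⟩ ⟨c, d, hg⟩
    refine ⟨a * c, (a : R) * d + b, fun x => ?_⟩
    rw [Equiv.Perm.mul_apply, hg, hf, Units.val_mul]
    ring
  inv_mem' := by
    rintro f ⟨a, b, hf⟩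
    refine ⟨a⁻¹, -(((a⁻¹ : Rˣ) : R) * b), fun x => ?_⟩
    rw [Equiv.Perm.inv_eq_iff_eq, hf, mul_add, mul_neg, ← mul_assoc, ← mul_assoc,
      Units.mul_inv]
    ring

variable (R) in
/-- The ideal `I₀ = {x ∈ rad R : x rad R = 0}`. -/
def idealZero : Ideal R :=
  Ring.jacobson R ⊓ (Ring.jacobson R).annihilator

/-- `K ≤ Rˣ` is pure if the zero ideal is the only ideal `I` of `R` with `1 + I ⊆ K`
(equivalently, `K + I = K`). -/
def IsPure (K : Subgroup Rˣ) : Prop :=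
  ∀ I : Ideal R, (∀ x ∈ I, ∃ k ∈ K, (k : R) = 1 + x) → I = ⊥

/-- The image of `K ≤ Rˣ` in the unit group of `R / I`. -/
def unitsImage (I : Ideal R) (K : Subgroup Rˣ) : Subgroup (R ⧸ I)ˣ :=
  K.map (Units.map (Ideal.Quotient.mk I : R →* R ⧸ I))

end Ring

/-- `K` is strongly pure if it is pure and, unless `R` is a field, its image in the unit group of
`R / I₀` is strongly pure. For a finite local ring `R` that is not a field the ideal `I₀` is
nonzero, so the recursion ends. -/
inductive IsStronglyPure : (R : Type u) → [CommRing R] → Subgroup Rˣ → Prop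
  | mk {R : Type u} [CommRing R] (K : Subgroup Rˣ) (pure : IsPure K)
      (step : ¬ IsField R → IsStronglyPure (R ⧸ idealZero R) (unitsImage (idealZero R) K)) :
      IsStronglyPure R K

section Local

variable (R : Type u) [CommRing R] [IsLocalRing R]

/-- The Teichmüller group of a finite local ring with residue field of order `q`: the units
`t` with `t ^ (q - 1) = 1`. It is the unique subgroup of order `q - 1` of `Rˣ`, and `Rˣ` is
the direct product of it and the group of principal units. -/
noncomputable def teichmullerGroup : Subgroup Rˣ :=
  rootsOfUnity (Nat.card (IsLocalRing.ResidueField R) - 1) R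

/-- The group `1 + rad R` of principal units. -/
noncomputable def principalUnits : Subgroup Rˣ :=
  (Units.map (IsLocalRing.residue R : R →* IsLocalRing.ResidueField R)).ker

end Local

/-! An automorphism `f` satisfies `f y - f x = (y - x) * k` with `k ∈ K` depending on `x`, `y`; the
task is to make `k` constant.

If `K` meets the principal units trivially, elements of `K` are determined modulo `rad R`, and
comparing a few differences forces one `k`. This covers the Teichmüller case, and the prime residue
field case because there strong purity forces trivial intersection.

For strongly pure groups of principal units, recursion through `R / I₀` makes `f` affine modulo
`I₀`. Dividing out that slope leaves an error `φ` with values in `I₀`, a vector space over the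
residue field `F`. It descends to `F → I₀` with difference quotients in the additive group `H = {v :
1 + v ∈ K}`, which by purity contains no nonzero `F`-subspace. Such a map is affine: finite
differences reduce it to an additive map, and power sums kill every Frobenius term except the linear
one. -/

/-! ### Power sums and additive maps on finite fields -/

/-- Powers of `p` behave like a Sidon set modulo `p ^ n - 1`. -/
theorem pow_sub_one_dvd_iff {p n i j k : ℕ} (hp : 2 ≤ p) (hi : i < n) (hj : j < n)
    (hk : k < n) (hk0 : 0 < k) :
    ((p ^ n - 1 : ℤ) ∣ (p : ℤ) ^ i - 1 - p ^ j * (p ^ k - 1)) ↔ j = 0 ∧ i = k := by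
  constructor
  swap
  · rintro ⟨rfl, rfl⟩
    simp
  intro h
  -- As `p ^ n ≡ 1`, the exponent `k + j` may be reduced modulo `n` to `l`; `0 < k < n` gives `l ≠
  -- j`.
  obtain ⟨l, hl, hlj, hdvd⟩ : ∃ l < n, l ≠ j ∧
      ((p ^ n - 1 : ℤ) ∣ (p : ℤ) ^ i + p ^ j - p ^ l - 1) ∧ (j = 0 → l = k) := by
    rcases lt_or_ge (k + j) n with hlt | hge
    · refine ⟨k + j, hlt, by omega, ?_, by omega⟩
      convert h using 1
      ring
    · refine ⟨k + j - n, by omega, by omega, ?_, by omega⟩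
      have e : (p : ℤ) ^ j * p ^ k = p ^ (k + j - n) * p ^ n := by
        rw [← pow_add, ← pow_add]; congr 1; omega
      have := dvd_add h (Dvd.intro_left ((p : ℤ) ^ (k + j - n)) rfl)
      rwa [show (p : ℤ) ^ i - 1 - p ^ j * (p ^ k - 1) + p ^ (k + j - n) * (p ^ n - 1)
        = p ^ i + p ^ j - p ^ (k + j - n) - 1 by linear_combination -e] at this
  obtain ⟨hdvd, hlk⟩ := hdvd
  have hbound : ∀ a < n, 1 ≤ (p : ℤ) ^ a ∧ (p : ℤ) ^ a * 2 ≤ p ^ n := by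
    intro a ha
    refine ⟨one_le_pow₀ (by exact_mod_cast (by omega : 1 ≤ p)), ?_⟩
    calc (p : ℤ) ^ a * 2 ≤ p ^ a * p := by gcongr; exact_mod_cast hp
      _ = p ^ (a + 1) := (pow_succ _ _).symm
      _ ≤ p ^ n := pow_le_pow_right₀ (by exact_mod_cast (by omega : 1 ≤ p)) ha
  -- Each power lies between `1` and `p ^ n / 2`, so the absolute value is below the modulus.
  have h0 : (p : ℤ) ^ i + p ^ j - p ^ l - 1 = 0 := by
    have hi' := hbound i hi
    have hj' := hbound j hj
    have hl' := hbound l hl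
    refine Int.eq_zero_of_abs_lt_dvd hdvd ?_
    rw [abs_lt]
    constructor <;> linarith
  have hnat : p ^ i + p ^ j = p ^ l + 1 := by
    have : (p : ℤ) ^ i + p ^ j = p ^ l + 1 := by linarith
    exact_mod_cast this
  rcases Nat.eq_zero_or_pos j with rfl | hj0
  · refine ⟨rfl, ?_⟩
    rw [hlk rfl, pow_zero] at hnat
    exact Nat.pow_right_injective hp (Nat.add_right_cancel hnat)
  rcases Nat.eq_zero_or_pos i with rfl | hi0
  · rw [pow_zero, add_comm] at hnat
    exact absurd (Nat.pow_right_injective hp (Nat.add_right_cancel hnat)) hlj.symm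
  have h1 : p ∣ p ^ i + p ^ j := dvd_add (dvd_pow_self p hi0.ne') (dvd_pow_self p hj0.ne')
  rw [hnat] at h1
  rcases Nat.eq_zero_or_pos l with rfl | hl0
  · have hpi : p ^ 1 ≤ p ^ i := Nat.pow_le_pow_right (by omega) hi0
    have hpj : p ^ 1 ≤ p ^ j := Nat.pow_le_pow_right (by omega) hj0
    rw [pow_one] at hpi hpj
    rw [pow_zero] at hnat
    omega
  · have := (Nat.dvd_add_right (dvd_pow_self p hl0.ne')).1 h1
    have := Nat.le_of_dvd one_pos this
    omega

theorem sum_units_zpow (F : Type*) [Field F] [Fintype F] [DecidableEq F] (e : ℤ) :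
    ∑ x : Fˣ, ((x ^ e : Fˣ) : F) = if ((Fintype.card F - 1 : ℕ) : ℤ) ∣ e then -1 else 0 := by
  have hc : Fintype.card Fˣ = Fintype.card F - 1 := Fintype.card_units F
  have hpos : 0 < Fintype.card F - 1 := hc ▸ Fintype.card_pos
  obtain ⟨m, hm⟩ := Int.eq_ofNat_of_zero_le
    (Int.emod_nonneg e (b := ((Fintype.card F - 1 : ℕ) : ℤ)) (by omega))
  have key : ∀ x : Fˣ, ((x ^ e : Fˣ) : F) = (x : F) ^ m := by
    intro x
    rw [← zpow_mod_card, hc, hm]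
    simp
  simp_rw [key]
  rw [FiniteField.sum_pow_units]
  have hiff : Fintype.card F - 1 ∣ m ↔ ((Fintype.card F - 1 : ℕ) : ℤ) ∣ e := by
    rw [← Int.natCast_dvd_natCast, show (m : ℤ) = e % _ from hm.symm,
      Int.dvd_iff_emod_eq_zero, Int.emod_emod_of_dvd _ dvd_rfl, ← Int.dvd_iff_emod_eq_zero]
  simp only [hiff]

/-- An additive map on a finite field is a linearized polynomial. -/
theorem AddMonoidHom.exists_eq_sum_frobenius {F V : Type*} [Field F] [Finite F] [AddCommGroup V]
    [Module F V] (p : ℕ) [Fact p.Prime] [Algebra (ZMod p) F] [Module (ZMod p) V]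
    [IsScalarTower (ZMod p) F V] (φ : F →+ V) :
    ∃ a : ℕ → V, ∀ x,
      φ x = ∑ i ∈ Finset.range (Module.finrank (ZMod p) F), x ^ p ^ i • a i := by
  classical
  have : Module.Finite (ZMod p) F := Module.Finite.of_finite
  let b := Module.finBasis (ZMod p) F
  have hB := traceForm_nondegenerate (ZMod p) F
  let d := (Algebra.traceForm (ZMod p) F).dualBasis hB b
  refine ⟨fun i => ∑ s, b s ^ p ^ i • φ (d s), fun x => ?_⟩
  -- Expand `x` in the trace-dual basis; the trace is a sum of Frobenius powers.
  have hx : φ x = ∑ s, Algebra.trace (ZMod p) F (x * b s) • φ (d s) := by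
    conv_lhs => rw [← d.sum_repr x, ← AddMonoidHom.coe_toZModLinearMap p φ]
    rw [map_sum]
    refine Finset.sum_congr rfl fun s _ => ?_
    rw [map_smul, LinearMap.BilinForm.dualBasis_repr_apply, Algebra.traceForm_apply]
    rfl
  rw [hx]
  simp_rw [Finset.smul_sum]
  rw [Finset.sum_comm]
  refine Finset.sum_congr rfl fun s _ => ?_
  rw [← algebraMap_smul F, FiniteField.algebraMap_trace_eq_sum_pow, Finset.sum_smul,
    Nat.card_zmod]
  exact Finset.sum_congr rfl fun i _ => by rw [mul_pow, mul_smul]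

/-- Write `φ x = ∑ x ^ p ^ i • a i`. Suitable weighted sums of the `x⁻¹ • φ x` isolate `-(b • a k)`
in `H` for every `b`, so `a k = 0` for `0 < k`. -/
theorem AddMonoidHom.eq_smul_of_mem_smul {F V : Type*} [Field F] [Finite F] [AddCommGroup V]
    [Module F V] (p : ℕ) [Fact p.Prime] [Algebra (ZMod p) F] [Module (ZMod p) V]
    [IsScalarTower (ZMod p) F V] (H : AddSubgroup V)
    (hH : ∀ v, (∀ c : F, c • v ∈ H) → v = 0) (φ : F →+ V)
    (hφ : ∀ x : F, x ≠ 0 → x⁻¹ • φ x ∈ H) (x : F) : φ x = x • φ 1 := by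
  classical
  have := Fintype.ofFinite F
  have : Module.Finite (ZMod p) F := Module.Finite.of_finite
  have : CharP F p := charP_of_injective_algebraMap (algebraMap (ZMod p) F).injective p
  obtain ⟨a, ha⟩ := φ.exists_eq_sum_frobenius p
  set n := Module.finrank (ZMod p) F with hn
  have hn0 : 0 < n := Module.finrank_pos
  have hp2 : 2 ≤ p := (Fact.out : p.Prime).two_le
  have hcard : ((Fintype.card F - 1 : ℕ) : ℤ) = (p : ℤ) ^ n - 1 := by
    rw [Module.card_eq_pow_finrank (K := ZMod p) (V := F), ZMod.card, ← hn,
      Nat.cast_sub (Nat.one_le_pow _ _ (by omega))]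
    push_cast
    rfl
  have ha0 : ∀ k < n, 0 < k → a k = 0 := by
    intro k hk hk0
    refine hH _ fun b => ?_
    -- The weights are traces because `H` is closed only under scalars from the prime field.
    have hmem : ∑ x : Fˣ, Algebra.trace (ZMod p) F (b * ((x ^ (-((p : ℤ) ^ k - 1)) : Fˣ) : F)) •
        ((x : F)⁻¹ • φ x) ∈ H :=
      H.sum_mem fun x _ =>
        (AddSubgroup.toZModSubmodule p H).smul_mem _ (hφ _ x.ne_zero)
    have hsum : ∑ x : Fˣ, Algebra.trace (ZMod p) F (b * ((x ^ (-((p : ℤ) ^ k - 1)) : Fˣ) : F)) •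
        ((x : F)⁻¹ • φ x) = -(b • a k) := by
      have hterm : ∀ x : Fˣ,
          Algebra.trace (ZMod p) F (b * ((x ^ (-((p : ℤ) ^ k - 1)) : Fˣ) : F)) •
            ((x : F)⁻¹ • φ x) = ∑ i ∈ Finset.range n, ∑ j ∈ Finset.range n,
            (b ^ p ^ j * ((x ^ ((p : ℤ) ^ i - 1 - p ^ j * (p ^ k - 1)) : Fˣ) : F)) • a i := by
        intro x
        rw [← algebraMap_smul F, FiniteField.algebraMap_trace_eq_sum_pow, Nat.card_zmod, ← hn,
          ha, Finset.smul_sum, Finset.smul_sum]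
        refine Finset.sum_congr rfl fun i _ => ?_
        rw [Finset.sum_smul]
        refine Finset.sum_congr rfl fun j _ => ?_
        rw [← mul_smul, ← mul_smul, mul_pow]
        congr 1
        have : x ^ ((p : ℤ) ^ i - 1 - p ^ j * (p ^ k - 1))
            = (x ^ (-((p : ℤ) ^ k - 1))) ^ p ^ j * (x⁻¹ * x ^ p ^ i) := by
          rw [← zpow_natCast, ← zpow_natCast x, ← zpow_mul, ← zpow_neg_one, ← zpow_add,
            ← zpow_add]
          congr 1
          push_cast
          ring
        rw [this]
        simp [mul_assoc]
      rw [Finset.sum_congr rfl fun x _ => hterm x, Finset.sum_comm]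
      have hin : ∀ i ∈ Finset.range n, ∑ x : Fˣ, ∑ j ∈ Finset.range n,
          (b ^ p ^ j * ((x ^ ((p : ℤ) ^ i - 1 - p ^ j * (p ^ k - 1)) : Fˣ) : F)) • a i
          = ∑ j ∈ Finset.range n, (if j = 0 ∧ i = k then -(b • a k) else 0) := by
        intro i hi
        rw [Finset.sum_comm]
        refine Finset.sum_congr rfl fun j hj => ?_
        rw [← Finset.sum_smul, ← Finset.mul_sum, sum_units_zpow, hcard]
        simp only [pow_sub_one_dvd_iff hp2 (Finset.mem_range.1 hi) (Finset.mem_range.1 hj) hk hk0]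
        split_ifs with h
        · obtain ⟨rfl, rfl⟩ := h
          simp
        · simp
      rw [Finset.sum_congr rfl hin]
      simp [ite_and, Finset.sum_ite_eq', hk, hn0]
    rw [hsum] at hmem
    exact neg_mem_iff.1 hmem
  have key : ∀ x, φ x = x • a 0 := by
    intro x
    rw [ha, Finset.sum_eq_single_of_mem 0 (Finset.mem_range.2 hn0)]
    · simp
    · intro i hi hi0
      rw [ha0 i (Finset.mem_range.1 hi) (Nat.pos_of_ne_zero hi0), smul_zero]
  rw [key x, key 1, one_smul]

/-! ### Finite differences -/

/-- All `n`-fold iterated differences of the function vanish. -/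
def DiffVanish {F V : Type*} [AddCommMonoid F] [AddCommGroup V] : ℕ → (F → V) → Prop
  | 0, φ => φ = 0
  | n + 1, φ => ∀ t, DiffVanish n (fwdDiff t φ)

namespace DiffVanish

section AddCommGroup

variable {F V : Type*} [AddCommMonoid F] [AddCommGroup V]

theorem zero : ∀ n : ℕ, DiffVanish n (0 : F → V)
  | 0 => rfl
  | n + 1 => fun t => by
    rw [show fwdDiff t (0 : F → V) = 0 by funext x; simp [fwdDiff]]
    exact zero n

theorem succ : ∀ {n : ℕ} {φ : F → V}, DiffVanish n φ → DiffVanish (n + 1) φ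
  | 0, _, h => by
    rw [show _ = (0 : F → V) from h]
    exact zero 1
  | _ + 1, _, h => fun t => (h t).succ

theorem mono {m n : ℕ} (h : m ≤ n) {φ : F → V} (hφ : DiffVanish m φ) : DiffVanish n φ := by
  induction h with
  | refl => exact hφ
  | step _ ih => exact ih.succ

theorem add : ∀ {n : ℕ} {φ ψ : F → V}, DiffVanish n φ → DiffVanish n ψ → DiffVanish n (φ + ψ)
  | 0, _, _, h, h' => by
    rw [show _ = (0 : F → V) from h, show _ = (0 : F → V) from h', add_zero]
    exact zero 0
  | _ + 1, _, _, h, h' => fun t => by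
    rw [fwdDiff_add]
    exact (h t).add (h' t)

theorem sum {n : ℕ} {ι : Type*} (s : Finset ι) (φ : ι → F → V)
    (h : ∀ i ∈ s, DiffVanish n (φ i)) : DiffVanish n (∑ i ∈ s, φ i) := by
  classical
  induction s using Finset.induction_on with
  | empty => exact zero n
  | insert i s hi ih =>
    rw [Finset.sum_insert hi]
    exact (h i (Finset.mem_insert_self i s)).add
      (ih fun j hj => h j (Finset.mem_insert_of_mem hj))

end AddCommGroup

theorem sub_pow_smul {F V : Type*} [CommRing F] [AddCommGroup V] [Module F V] (y : F) (k : ℕ) :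
    ∀ v : V, DiffVanish (k + 1) (fun x : F => (x - y) ^ k • v) := by
  induction k using Nat.strong_induction_on with
  | _ k ih =>
    intro v t
    have : fwdDiff t (fun x : F => (x - y) ^ k • v)
        = ∑ m ∈ Finset.range k, fun x : F => (x - y) ^ m • ((t ^ (k - m) * k.choose m) • v) := by
      funext x
      rw [fwdDiff, Finset.sum_apply, ← sub_smul, show x + t - y = (x - y) + t by ring, add_pow,
        Finset.sum_range_succ]
      simp only [tsub_self, pow_zero, mul_one, Nat.choose_self, Nat.cast_one, add_sub_cancel_right]
      rw [Finset.sum_smul]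
      exact Finset.sum_congr rfl fun m _ => by rw [← mul_smul, mul_assoc]
    rw [this]
    exact sum _ _ fun m hm =>
      (ih m (Finset.mem_range.1 hm) _).mono (Finset.mem_range.1 hm)

/-- Interpolation: `1 - (x - y) ^ (q - 1)` is the indicator of `y`, so every function on `F` is a
polynomial of degree below `q`. -/
theorem card {F V : Type*} [Field F] [Fintype F] [AddCommGroup V] [Module F V] (φ : F → V) :
    DiffVanish (Fintype.card F) φ := by
  classical
  have hq : 1 < Fintype.card F := Fintype.one_lt_card
  have : φ = ∑ y, ((fun x : F => (x - y) ^ 0 • φ y) +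
      fun x : F => (x - y) ^ (Fintype.card F - 1) • -φ y) := by
    funext x
    rw [Finset.sum_apply, Finset.sum_eq_single x]
    · simp [show Fintype.card F - 1 ≠ 0 by omega]
    · intro y _ hy
      simp [FiniteField.pow_card_sub_one_eq_one _ (sub_ne_zero.2 hy.symm)]
    · simp
  rw [this]
  exact sum _ _ fun y _ => ((sub_pow_smul y 0 _).mono (by omega)).add
    ((sub_pow_smul y _ _).mono (by omega))

end DiffVanish

/-- A function on a finite field all of whose difference quotients lie in an additive group
without nonzero subspaces is affine. -/
theorem exists_eq_smul_add_of_sub_mem_smul {F V : Type*} [Field F] [Finite F] [AddCommGroup V]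
    [Module F V] (H : AddSubgroup V) (hH : ∀ v, (∀ c : F, c • v ∈ H) → v = 0) (φ : F → V)
    (hφ : ∀ x y, ∃ h ∈ H, φ x - φ y = (x - y) • h) : ∃ h ∈ H, ∀ x, φ x = x • h + φ 0 := by
  have := Fintype.ofFinite F
  let p := ringChar F
  have : Fact p.Prime := ⟨CharP.char_is_prime F _⟩
  let _ : Algebra (ZMod p) F := ZMod.algebra F p
  let _ : Module (ZMod p) V := Module.compHom V (algebraMap (ZMod p) F)
  have : IsScalarTower (ZMod p) F V := .of_algebraMap_smul fun _ _ => rfl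
  have hvanish := DiffVanish.card φ
  generalize Fintype.card F = n at hvanish
  induction n generalizing φ with
  | zero =>
    rw [show φ = 0 from hvanish]
    exact ⟨0, H.zero_mem, by simp⟩
  | succ n ih =>
    have hdiff : ∀ t, ∃ h ∈ H, ∀ x, fwdDiff t φ x = x • h + fwdDiff t φ 0 := by
      intro t
      refine ih _ (fun x y => ?_) (hvanish t)
      obtain ⟨h₁, hh₁, e₁⟩ := hφ (x + t) (y + t)
      obtain ⟨h₂, hh₂, e₂⟩ := hφ x y
      refine ⟨h₁ - h₂, H.sub_mem hh₁ hh₂, ?_⟩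
      rw [add_sub_add_right_eq_sub] at e₁
      rw [smul_sub, ← e₁, ← e₂]
      simp only [fwdDiff]
      abel
    choose h hhH hh using hdiff
    simp only [fwdDiff, zero_add] at hh
    -- The mixed second difference in directions `t` and `1` is symmetric.
    have hlin : ∀ t, h t = t • h 1 := by
      intro t
      have e₁ := hh t 1
      have e₂ := hh 1 t
      rw [one_smul] at e₁
      rw [add_comm 1 t] at e₁
      have : h t = φ (t + 1) - φ 1 - (φ t - φ 0) := by rw [e₁]; abel
      rw [this, ← sub_eq_iff_eq_add.2 e₂]
      abel
    -- The slopes `h c = c • h 1` fill a subspace inside `H`, so they vanish and `φ - φ 0` is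
    -- additive.
    have h1 : h 1 = 0 := hH _ fun c => hlin c ▸ hhH c
    have hadd : ∀ x t, φ (x + t) - φ 0 = (φ x - φ 0) + (φ t - φ 0) := by
      intro x t
      have e := hh t x
      rw [hlin t, h1, smul_zero, smul_zero, zero_add, sub_eq_iff_eq_add] at e
      rw [e]
      abel
    let ψ : F →+ V := AddMonoidHom.mk' (fun x => φ x - φ 0) hadd
    have hψ : ∀ x : F, x ≠ 0 → x⁻¹ • ψ x ∈ H := by
      intro x hx
      obtain ⟨k, hk, e⟩ := hφ x 0
      rw [sub_zero] at e
      rw [show ψ x = x • k from e, inv_smul_smul₀ hx]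
      exact hk
    refine ⟨ψ 1, by simpa using hψ 1 one_ne_zero, fun x => ?_⟩
    rw [← ψ.eq_smul_of_mem_smul p H hH hψ x]
    exact (sub_add_cancel _ _).symm

/-! ### Local rings and the ideal `I₀` -/

open IsLocalRing

theorem isPure_eq_zero {R : Type u} [CommRing R] {K : Subgroup Rˣ} (hK : IsPure K) {x : R}
    (h : ∀ r : R, ∃ k ∈ K, (k : R) = 1 + r * x) : x = 0 := by
  have := hK (Ideal.span {x}) fun y hy => by
    obtain ⟨r, rfl⟩ := Ideal.mem_span_singleton'.1 hy
    exact h r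
  exact Ideal.span_singleton_eq_bot.1 this

section Local

variable {R : Type u} [CommRing R] [IsLocalRing R]

theorem mul_eq_zero_of_mem_maximalIdeal_of_mem_idealZero {x y : R} (hx : x ∈ maximalIdeal R)
    (hy : y ∈ idealZero R) : x * y = 0 := by
  rw [mul_comm]
  refine Submodule.mem_annihilator.1 hy.2 x ?_
  rwa [ringJacobson_eq_maximalIdeal]

theorem idealZero_le_maximalIdeal : idealZero R ≤ maximalIdeal R := by
  rw [← ringJacobson_eq_maximalIdeal]
  exact inf_le_left

instance : IsLocalRing (R ⧸ idealZero R) :=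
  have : Nontrivial (R ⧸ idealZero R) := Ideal.Quotient.nontrivial_iff.2
    (ne_top_of_le_ne_top (maximalIdeal.isMaximal R).ne_top idealZero_le_maximalIdeal)
  IsLocalRing.of_surjective' _ Ideal.Quotient.mk_surjective

theorem mk_mem_maximalIdeal_iff {x : R} :
    Ideal.Quotient.mk (idealZero R) x ∈ maximalIdeal (R ⧸ idealZero R) ↔ x ∈ maximalIdeal R := by
  have : IsLocalHom (Ideal.Quotient.mk (idealZero R)) :=
    IsLocalHom.of_surjective _ Ideal.Quotient.mk_surjective
  simp [mem_maximalIdeal, mem_nonunits_iff]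

theorem mem_idealZero_of_unit_mul_mem {u x : R} (hu : u ∉ maximalIdeal R)
    (h : u * x ∈ idealZero R) : x ∈ idealZero R :=
  ((idealZero R).unit_mul_mem_iff_mem (notMem_maximalIdeal.1 hu)).1 h

/-- The elements `v` of `I₀` with `1 + v ∈ K`. -/
def idealZeroPart (K : Subgroup Rˣ) : AddSubgroup (idealZero R) where
  carrier := {v | ∃ k ∈ K, (k : R) = 1 + v}
  zero_mem' := ⟨1, K.one_mem, by simp⟩
  add_mem' := by
    rintro v w ⟨k, hk, ek⟩ ⟨l, hl, el⟩
    refine ⟨k * l, K.mul_mem hk hl, ?_⟩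
    have := mul_eq_zero_of_mem_maximalIdeal_of_mem_idealZero (idealZero_le_maximalIdeal v.2) w.2
    rw [Units.val_mul, ek, el]
    push_cast
    linear_combination this
  neg_mem' := by
    rintro v ⟨k, hk, ek⟩
    refine ⟨k⁻¹, K.inv_mem hk, ?_⟩
    have := mul_eq_zero_of_mem_maximalIdeal_of_mem_idealZero (idealZero_le_maximalIdeal v.2) v.2
    refine k.isUnit.mul_left_cancel ?_
    rw [Units.mul_inv, ek]
    push_cast
    linear_combination this

/-- Since `rad R` kills `I₀`, the problem descends to the residue field once `φ` is constant on
cosets of `rad R`. -/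
theorem exists_eq_mul_of_mem_idealZero [Finite R] {K : Subgroup Rˣ} (hK : IsPure K) (φ : R → R)
    (h0 : φ 0 = 0) (hφ0 : ∀ x, φ x ∈ idealZero R)
    (hφ : ∀ x y, ∃ k ∈ K, φ x - φ y = (x - y) * (k - 1)) :
    ∃ k ∈ K, ∀ x, φ x = x * (k - 1) := by
  let _ : Field (R ⧸ maximalIdeal R) := Ideal.Quotient.field _
  let _ : Module (R ⧸ maximalIdeal R) (idealZero R) := Module.IsTorsionBySet.module
    (I := maximalIdeal R) fun v a =>
      Subtype.ext (mul_eq_zero_of_mem_maximalIdeal_of_mem_idealZero a.2 v.2)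
  have : Finite (R ⧸ maximalIdeal R) := .of_surjective _ Ideal.Quotient.mk_surjective
  have smul_def : ∀ (r : R) (v : idealZero R),
      ((Ideal.Quotient.mk (maximalIdeal R) r • v : idealZero R) : R) = r * v := fun _ _ => rfl
  have hH : ∀ v : idealZero R, (∀ c : R ⧸ maximalIdeal R, c • v ∈ idealZeroPart K) → v = 0 := by
    intro v hv
    exact Subtype.ext (isPure_eq_zero hK fun r => hv (Ideal.Quotient.mk _ r))
  have hunit : ∀ x y, x - y ∉ maximalIdeal R → ∃ h ∈ idealZeroPart K, φ x - φ y = (x - y) * h := by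
    intro x y hxy
    obtain ⟨k, hk, e⟩ := hφ x y
    have hmem : (k : R) - 1 ∈ idealZero R := mem_idealZero_of_unit_mul_mem hxy
      (e ▸ (idealZero R).sub_mem (hφ0 x) (hφ0 y))
    exact ⟨⟨k - 1, hmem⟩, ⟨k, hk, by simp⟩, e⟩
  have hrad : ∀ x y, x - y ∈ maximalIdeal R → φ x = φ y := by
    intro x y hxy
    let v : idealZero R := ⟨φ x - φ y, (idealZero R).sub_mem (hφ0 x) (hφ0 y)⟩
    suffices v = 0 from sub_eq_zero.1 (congrArg Subtype.val this)
    refine hH v fun c => ?_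
    obtain ⟨r, rfl⟩ := Ideal.Quotient.mk_surjective c
    by_cases hr : r ∈ maximalIdeal R
    · rw [Ideal.Quotient.eq_zero_iff_mem.2 hr, zero_smul]
      exact zero_mem _
    obtain ⟨u, rfl⟩ := notMem_maximalIdeal.1 hr
    have hu : ((u⁻¹ : Rˣ) : R) ∉ maximalIdeal R := notMem_maximalIdeal.2 (Units.isUnit _)
    -- Pass through `x - u⁻¹`, at unit distance from `x` and `y`: the two quotients give `u * (φ x -
    -- φ y) = h₁ - h₂`.
    obtain ⟨h₁, hh₁, e₁⟩ := hunit x (x - (u⁻¹ : Rˣ)) (by simp [-mem_maximalIdeal, hu])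
    obtain ⟨h₂, hh₂, e₂⟩ := hunit (x - (u⁻¹ : Rˣ)) y fun h => hu <| by
      have := (maximalIdeal R).sub_mem hxy h
      rwa [show x - y - (x - (u⁻¹ : Rˣ) - y) = ((u⁻¹ : Rˣ) : R) by ring] at this
    convert sub_mem hh₁ hh₂
    refine Subtype.ext ?_
    rw [smul_def]
    change (u : R) * (φ x - φ y) = h₁ - h₂
    have e₃ := mul_eq_zero_of_mem_maximalIdeal_of_mem_idealZero hxy h₂.2
    linear_combination (u : R) * e₁ + (u : R) * e₂ + (u : R) * e₃ + ((h₁ : R) - h₂) * u.mul_inv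
  have hout : ∀ c : R ⧸ maximalIdeal R, Ideal.Quotient.mk _ c.out = c := Ideal.Quotient.mk_out
  obtain ⟨h, ⟨k, hk, ek⟩, hh⟩ := exists_eq_smul_add_of_sub_mem_smul (idealZeroPart K) hH
    (fun c : R ⧸ maximalIdeal R => (⟨φ c.out, hφ0 _⟩ : idealZero R)) fun c d => by
      by_cases hcd : c = d
      · exact ⟨0, zero_mem _, by simp [hcd]⟩
      · obtain ⟨h, hh, e⟩ := hunit c.out d.out fun hmem => hcd <| by
          rw [← hout c, ← hout d]
          exact Ideal.Quotient.eq.2 hmem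
        refine ⟨h, hh, Subtype.ext ?_⟩
        conv_rhs => rw [← hout c, ← hout d, ← map_sub]
        rw [smul_def]
        exact e
  have hval : ∀ x : R, φ (Ideal.Quotient.mk (maximalIdeal R) x).out = φ x := fun x =>
    hrad _ _ (Ideal.Quotient.eq.1 (hout _))
  refine ⟨k, hk, fun x => ?_⟩
  have := congrArg Subtype.val (hh (Ideal.Quotient.mk _ x))
  rw [← map_zero (Ideal.Quotient.mk (maximalIdeal R)), Submodule.coe_add, smul_def] at this
  simp only [hval] at this
  rw [this, h0, ek]
  ring

/-- Functions preserving the relations of `Cyc(K, R)` are affine if `K` is a strongly pure group of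
principal units. -/
theorem IsStronglyPure.exists_eq_mul_add {R : Type u} [CommRing R] {K : Subgroup Rˣ}
    (h : IsStronglyPure R K) : ∀ [Finite R] [IsLocalRing R],
      (∀ k ∈ K, (k : R) - 1 ∈ maximalIdeal R) → ∀ f : R → R,
      (∀ x y, ∃ k ∈ K, f y - f x = (y - x) * k) → ∃ k ∈ K, ∀ x, f x = k * x + f 0 := by
  induction h with
  | @mk R _ K pure _ ih =>
  intro _ _ hKU f hf
  by_cases hR : IsField R
  · refine ⟨1, K.one_mem, fun x => ?_⟩
    obtain ⟨k, hk, e⟩ := hf 0 x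
    have hk1 := hKU k hk
    rw [isField_iff_maximalIdeal_eq.1 hR, Ideal.mem_bot, sub_eq_zero] at hk1
    rw [hk1] at e
    rw [Units.val_one]
    linear_combination e
  have : Finite (R ⧸ idealZero R) := .of_surjective _ Ideal.Quotient.mk_surjective
  let π := Ideal.Quotient.mk (idealZero R)
  have hπ : ∀ x y, ∃ k ∈ K, π (f y) - π (f x) = (π y - π x) * π k := by
    intro x y
    obtain ⟨k, hk, e⟩ := hf x y
    exact ⟨k, hk, by rw [← map_sub, e, map_mul, map_sub]⟩
  have hout : ∀ c : R ⧸ idealZero R, π c.out = c := Ideal.Quotient.mk_out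
  obtain ⟨_, ⟨k, hk, rfl⟩, hk'⟩ := ih hR (by
      rintro _ ⟨k, hk, rfl⟩
      rw [Units.coe_map, ← map_one (Ideal.Quotient.mk (idealZero R))]
      change π k - π 1 ∈ _
      rw [← map_sub]
      exact mk_mem_maximalIdeal_iff.2 (hKU k hk)) (fun c => π (f c.out)) fun c d => by
      obtain ⟨k, hk, e⟩ := hπ c.out d.out
      rw [hout, hout] at e
      exact ⟨_, ⟨k, hk, rfl⟩, e⟩
  -- The induced map on `R / I₀` does not depend on representatives.
  have hval : ∀ x, π (f (π x).out) = π (f x) := by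
    intro x
    obtain ⟨k, _, e⟩ := hπ x (π x).out
    rwa [hout, sub_self, zero_mul, sub_eq_zero] at e
  have hφ0 : ∀ x, ((k⁻¹ : Rˣ) : R) * (f x - f 0) - x ∈ idealZero R := by
    intro x
    have e := hk' (π x)
    rw [← map_zero π] at e
    simp only [hval] at e
    change π (f x) = π k * π x + π (f 0) at e
    rw [← map_mul, ← map_add, Ideal.Quotient.eq] at e
    convert (idealZero R).mul_mem_left ((k⁻¹ : Rˣ) : R) e using 1
    linear_combination x * k.inv_mul
  obtain ⟨l, hl, e⟩ := exists_eq_mul_of_mem_idealZero pure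
    (fun x => ((k⁻¹ : Rˣ) : R) * (f x - f 0) - x) (by simp) hφ0 fun x y => by
      obtain ⟨l, hl, e⟩ := hf y x
      refine ⟨k⁻¹ * l, K.mul_mem (K.inv_mem hk) hl, ?_⟩
      rw [Units.val_mul]
      linear_combination ((k⁻¹ : Rˣ) : R) * e
  refine ⟨k * l, K.mul_mem hk hl, fun x => ?_⟩
  rw [Units.val_mul]
  linear_combination (k : R) * e x - (f x - f 0) * k.mul_inv

/-! ### Groups without nontrivial principal units -/

theorem exists_eq_mul_add_of_eq_one_of_sub_mem (hR : ¬ IsField R) {K : Subgroup Rˣ}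
    (hK : ∀ k ∈ K, (k : R) - 1 ∈ maximalIdeal R → k = 1) (f : R → R)
    (hf : ∀ x y, ∃ k ∈ K, f y - f x = (y - x) * k) : ∃ k ∈ K, ∀ x, f x = k * x + f 0 := by
  have hinj : ∀ s ∈ K, ∀ t ∈ K, (s : R) - t ∈ maximalIdeal R → s = t := by
    intro s hs t ht hst
    refine mul_inv_eq_one.1 (hK (s * t⁻¹) (K.mul_mem hs (K.inv_mem ht)) ?_)
    convert (maximalIdeal R).mul_mem_left ((t⁻¹ : Rˣ) : R) hst using 1
    rw [Units.val_mul]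
    linear_combination t.inv_mul
  -- A nonzero `z` in the radical is the test point: below, `(k - t) * z = 0` makes `k - t` a
  -- nonunit.
  obtain ⟨z, hz, hz0⟩ := Submodule.exists_mem_ne_zero_of_ne_bot
    (mt isField_iff_maximalIdeal_eq.2 hR)
  obtain ⟨k, hk, ek⟩ := hf 0 1
  have hrad : ∀ z ∈ maximalIdeal R, f z = k * z + f 0 := by
    intro z hz
    obtain ⟨t, _, et⟩ := hf 0 z
    obtain ⟨s, hs, es⟩ := hf z 1
    have : k = s := hinj k hk s hs <| by
      convert (maximalIdeal R).mul_mem_left ((t : R) - s) hz using 1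
      linear_combination es + et - ek
    subst this
    linear_combination ek - es
  refine ⟨k, hk, fun u => ?_⟩
  by_cases hu : u ∈ maximalIdeal R
  · exact hrad u hu
  obtain ⟨u, rfl⟩ := notMem_maximalIdeal.1 hu
  obtain ⟨t, ht, et⟩ := hf 0 u
  obtain ⟨s, hs, es⟩ := hf z u
  rw [hrad z hz] at es
  have : t = s := hinj t ht s hs <| by
    convert (maximalIdeal R).mul_mem_left (((u⁻¹ : Rˣ) : R) * (k - s)) hz using 1
    linear_combination ((u⁻¹ : Rˣ) : R) * (es - et) - ((t : R) - s) * u.inv_mul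
  subst this
  have hzero : ((k : R) - t) * z = 0 := by linear_combination et - es
  have : k = t := hinj k hk t ht <| by
    by_contra hkt
    exact hz0 ((notMem_maximalIdeal.1 hkt).mul_right_eq_zero.1 hzero)
  subst this
  linear_combination et

/-- If the residue field is generated by `1`, strongly pure groups contain no nontrivial principal
units. -/
theorem IsStronglyPure.eq_one_of_sub_mem {R : Type u} [CommRing R] {K : Subgroup Rˣ}
    (h : IsStronglyPure R K) : ∀ [IsLocalRing R], (∀ r : R, ∃ n : ℕ, r - n ∈ maximalIdeal R) →
      ∀ k ∈ K, (k : R) - 1 ∈ maximalIdeal R → k = 1 := by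
  induction h with
  | @mk R _ K pure _ ih =>
  intro _ hR k hk hk1
  by_cases hfield : IsField R
  · rw [isField_iff_maximalIdeal_eq.1 hfield, Ideal.mem_bot, sub_eq_zero] at hk1
    exact Units.ext hk1
  have hkbar := ih hfield (fun c => by
      obtain ⟨r, rfl⟩ := Ideal.Quotient.mk_surjective c
      obtain ⟨n, hn⟩ := hR r
      exact ⟨n, by simpa using mk_mem_maximalIdeal_iff.2 hn⟩) _ ⟨k, hk, rfl⟩ (by
      simpa using mk_mem_maximalIdeal_iff.2 hk1)
  have hmem : (k : R) - 1 ∈ idealZero R := by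
    refine Ideal.Quotient.eq.1 ?_
    simpa using congrArg Units.val hkbar
  -- Multiples of `k - 1` by ring elements are integer multiples, so they stay in the additive group
  -- `idealZeroPart K`.
  have : (k : R) - 1 = 0 := isPure_eq_zero pure fun r => by
    obtain ⟨n, hn⟩ := hR r
    obtain ⟨l, hl, el⟩ := nsmul_mem
      (show (⟨k - 1, hmem⟩ : idealZero R) ∈ idealZeroPart K from ⟨k, hk, by simp⟩) n
    refine ⟨l, hl, ?_⟩
    rw [el]
    have e := mul_eq_zero_of_mem_maximalIdeal_of_mem_idealZero hn hmem
    simp only [Submodule.coe_smul_of_tower, nsmul_eq_mul]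
    linear_combination -e
  exact Units.ext (sub_eq_zero.1 this)

/-- In `x ^ n - 1 = (x - 1)(1 + ⋯ + x ^ (n - 1))` the second factor is congruent to the unit `n`. -/
theorem eq_one_of_pow_eq_one_of_sub_mem {n : ℕ} (hn : (n : R) ∉ maximalIdeal R) {x : R}
    (h : x ^ n = 1) (hx : x - 1 ∈ maximalIdeal R) : x = 1 := by
  have hg := mul_geom_sum x n
  rw [h, sub_self, mul_comm] at hg
  refine sub_eq_zero.1 ((notMem_maximalIdeal.1 fun hsum => hn ?_).mul_right_eq_zero.1 hg)
  rw [← residue_eq_zero_iff] at hx hsum ⊢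
  rw [map_sub, map_one, sub_eq_zero] at hx
  simpa [hx] using hsum

end Local

/-! ### The three cases -/

theorem mainTheorem8 (R : Type u) [CommRing R] [Finite R] [IsLocalRing R] (hR : ¬ IsField R)
    (K : Subgroup Rˣ)
    (h : K ≤ teichmullerGroup R ∨
      (IsStronglyPure R K ∧ K ≤ principalUnits R) ∨
      (IsStronglyPure R K ∧ (Nat.card (IsLocalRing.ResidueField R)).Prime)) :
    (Cyc K).aut ≤ AGLOne R := by
  have : Finite (ResidueField R) := .of_surjective _ residue_surjective
  intro f hf
  have hfK : ∀ x y, ∃ k ∈ K, f y - f x = (y - x) * k := by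
    intro x y
    have := hf _ ⟨y - x, rfl⟩
    have hmem : (f x, f y) ∈ Prod.map f f '' cycRel K (y - x) :=
      ⟨(x, y), mem_cycRel_self K (x, y), rfl⟩
    rwa [this] at hmem
  suffices ∃ k ∈ K, ∀ x, f x = k * x + f 0 by
    obtain ⟨k, _, hk⟩ := this
    exact ⟨k, f 0, hk⟩
  rcases h with hT | ⟨hK, hU⟩ | ⟨hK, hq⟩
  · refine exists_eq_mul_add_of_eq_one_of_sub_mem hR (fun k hk hk1 => ?_) f hfK
    have hpow := (mem_rootsOfUnity' _ _).1 (hT hk)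
    refine Units.ext (eq_one_of_pow_eq_one_of_sub_mem ?_ hpow hk1)
    have := Fintype.ofFinite (ResidueField R)
    -- The exponent `q - 1` is `-1` in the residue field.
    rw [← residue_eq_zero_iff, map_natCast, Nat.cast_sub Nat.card_pos, Nat.card_eq_fintype_card,
      FiniteField.cast_card_eq_zero]
    simp
  · refine hK.exists_eq_mul_add (fun k hk => ?_) f hfK
    rw [← residue_eq_zero_iff, map_sub, map_one, sub_eq_zero]
    exact congrArg Units.val (hU hk)
  · refine exists_eq_mul_add_of_eq_one_of_sub_mem hR (hK.eq_one_of_sub_mem fun r => ?_) f hfK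
    have := Fact.mk hq
    obtain ⟨n, hn⟩ := AddSubmonoid.mem_multiples_iff _ _ |>.1 <|
      mem_multiples_of_prime_card (G := ResidueField R) rfl (one_ne_zero) (g' := residue R r)
    refine ⟨n, ?_⟩
    rw [← residue_eq_zero_iff, map_sub, map_natCast, ← hn]
    simp
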